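/- Let $V=(V,Y,\mathbf 1,\omega)$ be a vertex operator algebra over $\mathbb C$: it is $\mathbb Z$-graded by eigenspaces of $L(0)$, $V=\bigoplus_{n\in\mathbb Z}V_n$ with $V_n=\{v\in V\mid L(0)v=nv\}$, each $V_n$ is finite-dimensional, and $V_n=0$ for all sufficiently small $n$; here $Y(\omega,z)=\sum_{n\in\mathbb Z}L(n)z^{-n-2}$. A weak $V$-module is a complex vector space $M$ with a linear map $v\mapsto Y_M(v,z)=\sum_{n\in\mathbb Z}v_nz^{-n-1}$, $v_n\in\mathrm{End}\,M$, such that $v_nw=0$ for $n$ large (for each $v\in V$, $w\in M$), $Y_M(\mathbf 1,z)=\mathrm{id}_M$, and the Jacobi identity holds. A $V$-module is a weak $V$-module $M$ with $M=\bigoplus_{\lambda\in\mathbb C}M_\lambda$, where $M_\lambda=\{w\in M\mid L(0)w=\lambda w\}$ is finite-dimensional for every $\lambda$ and, for each fixed $\lambda$, $M_{\lambda+n}=0$ for all sufficiently small integers $n$. A $V$-module is simple if it is nonzero and has no submodules (subspaces stable under all $v_n$) other than $0$ and itself. Suppose that $V$ is holomorphic, i.e. $V$ is itself a simple $V$-module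 and every simple $V$-module is isomorphic to $V$, and suppose that $V_1=0$. Then every $V$-module is completely reducible, i.e. is a direct sum of simple $V$-modules. -/

import Mathlib

universe u v

/-- The Jacobi identity for a state-field correspondence `YV` on `V` acting on `M` through `YM`,
$$z_0^{-1}\delta(\tfrac{z_1-z_2}{z_0})Y_M(a,z_1)Y_M(b,z_2)
  -z_0^{-1}\delta(\tfrac{z_2-z_1}{-z_0})Y_M(b,z_2)Y_M(a,z_1)
  =z_2^{-1}\delta(\tfrac{z_1-z_0}{z_2})Y_M(Y(a,z_0)b,z_2),$$
written out as the equality, applied to a vector `w`, of the coefficients of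
$z_0^{-l-1}z_1^{-m-1}z_2^{-n-1}$ for all integers `l m n`. Here `ncoeff A n` is the coefficient of
$z^{-n-1}$ in the field `A`. All three sums have finite support, since a `VertexOperator` takes
values in Laurent series. -/
def JacobiIdentity {V : Type u} [AddCommGroup V] [Module ℂ V]
    {M : Type v} [AddCommGroup M] [Module ℂ M]
    (YV : V →ₗ[ℂ] VertexOperator ℂ V) (YM : V →ₗ[ℂ] VertexOperator ℂ M) : Prop :=
  ∀ (a b : V) (w : M) (l m n : ℤ),
    (∑ᶠ i : ℕ, ((-1 : ℂ) ^ i * (Ring.choose l i : ℤ)) •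
        (YM a).ncoeff (l + m - i) ((YM b).ncoeff (n + i) w))
      - (∑ᶠ i : ℕ, ((-1 : ℂ) ^ l * (-1 : ℂ) ^ i * (Ring.choose l i : ℤ)) •
        (YM b).ncoeff (l + n - i) ((YM a).ncoeff (m + i) w))
      = ∑ᶠ i : ℕ, ((Ring.choose m i : ℤ) : ℂ) •
        (YM ((YV a).ncoeff (l + i) b)).ncoeff (m + n - i) w

/-- The structure of a vertex operator algebra on the complex vector space `V`. The
$\mathbb{Z}$-grading is the one by eigenspaces of $L(0)$, where
$Y(\omega,z)=\sum_n L(n)z^{-n-2}$, that is $L(n)=\omega_{n+1}$. -/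
structure VertexOperatorAlgebra (V : Type u) [AddCommGroup V] [Module ℂ V] where
  /-- The state-field correspondence; `VertexOperator` contains the truncation condition
  $a_n b = 0$ for $n \gg 0$. -/
  Y : V →ₗ[ℂ] VertexOperator ℂ V
  /-- The vacuum vector. -/
  vac : V
  /-- The conformal (Virasoro) vector. -/
  ω : V
  /-- The rank (central charge). -/
  rank : ℂ
  /-- $Y(\mathbf 1,z)=\mathrm{id}$. -/
  vacuum : ∀ n : ℤ, (Y vac).ncoeff n = if n = -1 then LinearMap.id else 0
  /-- $Y(a,z)\mathbf 1$ has no negative powers of $z$. -/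
  creation : ∀ (a : V) (n : ℤ), 0 ≤ n → (Y a).ncoeff n vac = 0
  /-- The constant term of $Y(a,z)\mathbf 1$ is `a`. -/
  creation_neg_one : ∀ a : V, (Y a).ncoeff (-1) vac = a
  jacobi : JacobiIdentity Y Y
  /-- The Virasoro relations. -/
  virasoro : ∀ (m n : ℤ) (a : V),
    (Y ω).ncoeff (m + 1) ((Y ω).ncoeff (n + 1) a)
        - (Y ω).ncoeff (n + 1) ((Y ω).ncoeff (m + 1) a)
      = ((m : ℂ) - n) • (Y ω).ncoeff (m + n + 1) a
        + (if m + n = 0 then (((m : ℂ) ^ 3 - m) / 12) * rank else 0) • a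
  /-- $Y(L(-1)a,z)=\frac{d}{dz}Y(a,z)$. -/
  derivative : ∀ (a : V) (n : ℤ),
    (Y ((Y ω).ncoeff 0 a)).ncoeff n = (-(n : ℂ)) • (Y a).ncoeff (n - 1)
  /-- `V` is the direct sum of the eigenspaces of $L(0)$ with integral eigenvalue. -/
  grading : DirectSum.IsInternal
    fun n : ℤ => Module.End.eigenspace ((Y ω).ncoeff 1) (n : ℂ)
  finite_dim : ∀ n : ℤ,
    FiniteDimensional ℂ (Module.End.eigenspace ((Y ω).ncoeff 1) (n : ℂ))
  bounded_below : ∃ N : ℤ, ∀ n : ℤ, n < N →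
    Module.End.eigenspace ((Y ω).ncoeff 1) (n : ℂ) = ⊥

namespace VertexOperatorAlgebra

variable {V : Type u} [AddCommGroup V] [Module ℂ V]

/-- The homogeneous space $V_n$ of weight `n`. -/
def weightSpace (A : VertexOperatorAlgebra V) (n : ℤ) : Submodule ℂ V :=
  Module.End.eigenspace ((A.Y A.ω).ncoeff 1) (n : ℂ)

/-- The structure of a weak module for the vertex operator algebra `A` on the vector space `M`. -/
structure WeakModule (A : VertexOperatorAlgebra V) (M : Type v) [AddCommGroup M] [Module ℂ M] where
  /-- The fields $Y_M(a,z)$; `VertexOperator` contains the truncation condition. -/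
  Y : V →ₗ[ℂ] VertexOperator ℂ M
  /-- $Y_M(\mathbf 1,z)=\mathrm{id}$. -/
  vacuum : ∀ n : ℤ, (Y A.vac).ncoeff n = if n = -1 then LinearMap.id else 0
  jacobi : JacobiIdentity A.Y Y

/-- `V` as a module over itself. -/
def adjoint (A : VertexOperatorAlgebra V) : A.WeakModule V where
  Y := A.Y
  vacuum := A.vacuum
  jacobi := A.jacobi

namespace WeakModule

variable {A : VertexOperatorAlgebra V}

/-- The mode $a_n$ acting on `M`, where $Y_M(a,z)=\sum_n a_n z^{-n-1}$. -/
def mode {M : Type v} [AddCommGroup M] [Module ℂ M] (W : A.WeakModule M) (a : V) (n : ℤ) :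
    Module.End ℂ M :=
  (W.Y a).ncoeff n

/-- The space $M_\lambda=\{w \mid L(0)w=\lambda w\}$. -/
def weightSpace {M : Type v} [AddCommGroup M] [Module ℂ M] (W : A.WeakModule M) (lam : ℂ) :
    Submodule ℂ M :=
  Module.End.eigenspace (W.mode A.ω 1) lam

/-- A weak module is an (ordinary) module if it is the direct sum of the eigenspaces $M_\lambda$
($\lambda\in\mathbb C$) of $L(0)$, every $M_\lambda$ is finite-dimensional and, for each fixed
$\lambda$, $M_{\lambda+n}=0$ for all sufficiently small integers $n$. -/
structure IsOrdinary {M : Type v} [AddCommGroup M] [Module ℂ M] (W : A.WeakModule M) :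
    Prop where
  grading : DirectSum.IsInternal W.weightSpace
  finite_dim : ∀ lam : ℂ, FiniteDimensional ℂ (W.weightSpace lam)
  bounded_below : ∀ lam : ℂ, ∃ N : ℤ, ∀ n : ℤ, n < N → W.weightSpace (lam + n) = ⊥

/-- Subspaces stable under all modes. A submodule of an ordinary module is automatically graded
by its $L(0)$-eigenspaces, hence again an ordinary module. -/
def IsSubmodule {M : Type v} [AddCommGroup M] [Module ℂ M] (W : A.WeakModule M)
    (N : Submodule ℂ M) : Prop :=
  ∀ (a : V) (n : ℤ), ∀ w ∈ N, W.mode a n w ∈ N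

/-- `M` is simple: it is nonzero and `0` and `M` are its only submodules. -/
def IsSimple {M : Type v} [AddCommGroup M] [Module ℂ M] (W : A.WeakModule M) : Prop :=
  Nontrivial M ∧ ∀ N : Submodule ℂ M, W.IsSubmodule N → N = ⊥ ∨ N = ⊤

/-- `N` is a submodule of `M` which is simple as a module. -/
def IsSimpleSubmodule {M : Type v} [AddCommGroup M] [Module ℂ M] (W : A.WeakModule M)
    (N : Submodule ℂ M) : Prop :=
  W.IsSubmodule N ∧ N ≠ ⊥ ∧
    ∀ N' : Submodule ℂ M, N' ≤ N → W.IsSubmodule N' → N' = ⊥ ∨ N' = N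

open scoped Classical in
/-- `M` is completely reducible: it is a direct sum of simple submodules. -/
def IsCompletelyReducible {M : Type v} [AddCommGroup M] [Module ℂ M] (W : A.WeakModule M) :
    Prop :=
  ∃ (ι : Type v) (S : ι → Submodule ℂ M),
    (∀ i, W.IsSimpleSubmodule (S i)) ∧ DirectSum.IsInternal S

/-- Equivalence (isomorphism) of modules: a linear isomorphism commuting with all modes. -/
def Equivalent {M : Type u} [AddCommGroup M] [Module ℂ M] {M' : Type v} [AddCommGroup M']
    [Module ℂ M'] (W : A.WeakModule M) (W' : A.WeakModule M') : Prop :=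
  ∃ e : M ≃ₗ[ℂ] M', ∀ (a : V) (n : ℤ) (w : M), e (W.mode a n w) = W'.mode a n (e w)

end WeakModule

/-- `V` is holomorphic: `V` is the only simple `V`-module up to equivalence, i.e. `V` is itself
simple, and every simple (ordinary) `V`-module is equivalent to `V`. -/
def IsHolomorphic (A : VertexOperatorAlgebra V) : Prop :=
  A.adjoint.IsSimple ∧
    ∀ (M : Type v) [AddCommGroup M] [Module ℂ M] (W : A.WeakModule M),
      W.IsOrdinary → W.IsSimple → A.adjoint.Equivalent W

end VertexOperatorAlgebra

/-!
A vector `w` of weight `0` has `L(-1) w` of weight `1`. Each homogeneous vector of a module survives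
in some simple subquotient, which is a copy of `V`; so `V₁ = 0` forces `M₁ = 0`, and `L(-1)` kills
`M₀`. A vector killed by `L(-1)` behaves like the vacuum: `a ↦ a₋₁ w` is a homomorphism `V → M`, and
its image is a simple submodule containing `w`. Thus `M₀` lies in the sum `S` of the simple
submodules, and `(M / S)₀ = 0`. As every nonzero module has a subquotient isomorphic to `V`, which
contains the vacuum, it has a nonzero vector of weight `0`; hence `M = S`.
-/

open Filter

section Eigenspace

variable {K M : Type*} [Field K] [AddCommGroup M] [Module K M] {f : Module.End K M}

theorem map_eigenspace_eq_of_surjective {Q : Type*} [AddCommGroup Q] [Module K Q]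
    {g : Module.End K Q} {p : M →ₗ[K] Q} (hp : Function.Surjective p)
    (hfg : ∀ x, p (f x) = g (p x)) (hf : ⨆ μ, f.eigenspace μ = ⊤) :
    (fun μ => (f.eigenspace μ).map p) = g.eigenspace := by
  have hle : (fun μ => (f.eigenspace μ).map p) ≤ g.eigenspace := by
    rintro μ _ ⟨x, hx, rfl⟩
    rw [Module.End.mem_eigenspace_iff, ← hfg, Module.End.mem_eigenspace_iff.1 hx, map_smul]
  have htop : ⨆ μ, (f.eigenspace μ).map p = ⊤ := by
    rw [← Submodule.map_iSup, hf, Submodule.map_top, LinearMap.range_eq_top.2 hp]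
  exact (g.eigenspaces_iSupIndep.le_iff_eq_of_iSup_eq_top htop).1 hle

theorem mem_of_sum_mem_of_mem_eigenspace {N : Submodule K M} (hN : ∀ x ∈ N, f x ∈ N)
    {s : Finset K} {y : K → M} (hy : ∀ μ ∈ s, y μ ∈ f.eigenspace μ) (hsum : ∑ μ ∈ s, y μ ∈ N) :
    ∀ μ ∈ s, y μ ∈ N := by
  -- In `M ⧸ N` the images are eigenvectors for distinct eigenvalues with sum zero.
  let g : Module.End K (M ⧸ N) := N.mapQ N f hN
  have hg : ∀ μ ∈ s, N.mkQ (y μ) ∈ g.eigenspace μ := fun μ hμ => by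
    rw [Module.End.mem_eigenspace_iff, ← map_smul, ← Module.End.mem_eigenspace_iff.1 (hy μ hμ)]
    rfl
  have hmk : ∑ μ ∈ s, N.mkQ (y μ) = 0 :=
    (map_sum N.mkQ y s).symm.trans ((Submodule.Quotient.mk_eq_zero N).2 hsum)
  have hzero := (iSupIndep_iff_finsetSum_eq_zero_imp_eq_zero _).1 g.eigenspaces_iSupIndep s
    (fun μ => N.mkQ (y μ)) hg hmk
  exact fun μ hμ => (Submodule.Quotient.mk_eq_zero N).1 (hzero μ hμ)

theorem iSup_comap_subtype_eigenspace_eq_top {N : Submodule K M} (hN : ∀ x ∈ N, f x ∈ N)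
    (hf : ⨆ μ, f.eigenspace μ = ⊤) : ⨆ μ, (f.eigenspace μ).comap N.subtype = ⊤ := by
  rw [eq_top_iff]
  rintro ⟨x, hx⟩ -
  obtain ⟨y, hy, rfl⟩ := (Submodule.mem_iSup_iff_exists_finsupp _ x).1
    (hf.symm ▸ Submodule.mem_top : x ∈ ⨆ μ, f.eigenspace μ)
  have hyN := mem_of_sum_mem_of_mem_eigenspace hN (fun μ _ => hy μ) hx
  have hsum : (⟨_, hx⟩ : N) = ∑ μ ∈ y.support.attach, ⟨y μ, hyN μ μ.2⟩ := by
    ext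
    simp only [AddSubmonoidClass.coe_finsetSum, Finset.sum_attach y.support y, Finsupp.sum]
  rw [hsum]
  exact Submodule.sum_mem _ fun μ _ => Submodule.mem_iSup_of_mem (μ : K) (hy μ)

end Eigenspace

section Fields

variable {R V M : Type*} [CommRing R] [AddCommGroup V] [Module R V] [AddCommGroup M] [Module R M]

theorem eventually_ncoeff_eq_zero (F : VertexOperator R M) (x : M) :
    ∀ᶠ n : ℤ in atTop, F.ncoeff n x = 0 := by
  filter_upwards [eventually_ge_atTop (-((HahnModule.of R).symm (F x)).order)] with n hn
  exact F.ncoeff_eq_zero_of_lt_order n x (by lia)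

theorem hasFiniteSupport_smul_map_ncoeff {Q : Type*} [AddCommGroup Q] [Module R Q]
    (F : VertexOperator R M) (x : M) (n : ℤ) (c : ℕ → R) (g : ℕ → M →ₗ[R] Q) :
    (fun i : ℕ => c i • g i (F.ncoeff (n + i) x)).HasFiniteSupport := by
  have hshift : Tendsto (fun i : ℕ => n + (i : ℤ)) atTop atTop :=
    tendsto_atTop_add_const_left _ _ tendsto_natCast_atTop_atTop
  refine eventually_cofinite.1 (Nat.cofinite_eq_atTop ▸ ?_)
  filter_upwards [hshift.eventually (eventually_ncoeff_eq_zero F x)] with i hi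
  rw [hi, map_zero, smul_zero]

theorem ncoeff_injective : Function.Injective (VertexOperator.ncoeff (R := R) (V := M)) := by
  refine fun F G h => HVertexOperator.coeff_inj (funext fun n => ?_)
  simp only [VertexOperator.coeff_eq_ncoeff, h]

theorem exists_ncoeff_eq {μ : ℤ → Module.End R M} (hμ : ∀ x, ∀ᶠ n in atTop, μ n x = 0) :
    ∃ F : VertexOperator R M, F.ncoeff = μ := by
  have hbdd (x : M) : BddBelow (Function.support fun k : ℤ => μ (-k - 1) x) := by
    obtain ⟨N, hN⟩ := eventually_atTop.1 (hμ x)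
    refine ⟨-N, fun k hk => ?_⟩
    by_contra hlt
    exact hk (hN _ (by lia))
  refine ⟨VertexOperator.of_coeff _ hbdd, funext fun n => ?_⟩
  rw [VertexOperator.ncoeff_of_coeff]
  congr 1
  lia

/-- The state-field correspondence with prescribed modes, for constructing weak modules out of
endomorphisms. -/
noncomputable def fieldOfModes (μ : V →ₗ[R] ℤ → Module.End R M)
    (hμ : ∀ a x, ∀ᶠ n in atTop, μ a n x = 0) : V →ₗ[R] VertexOperator R M where
  toFun a := (exists_ncoeff_eq (hμ a)).choose
  map_add' a b := ncoeff_injective <| (exists_ncoeff_eq (hμ (a + b))).choose_spec.trans <| by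
    rw [map_add, map_add, (exists_ncoeff_eq (hμ a)).choose_spec,
      (exists_ncoeff_eq (hμ b)).choose_spec]
  map_smul' c a := ncoeff_injective <| (exists_ncoeff_eq (hμ (c • a))).choose_spec.trans <| by
    rw [RingHom.id_apply, map_smul, map_smul, (exists_ncoeff_eq (hμ a)).choose_spec]

@[simp]
theorem ncoeff_fieldOfModes (μ : V →ₗ[R] ℤ → Module.End R M)
    (hμ : ∀ a x, ∀ᶠ n in atTop, μ a n x = 0) (a : V) : (fieldOfModes μ hμ a).ncoeff = μ a :=
  (exists_ncoeff_eq (hμ a)).choose_spec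

end Fields

section Jacobi

variable {V M Q : Type*} [AddCommGroup V] [Module ℂ V] [AddCommGroup M] [Module ℂ M]
  [AddCommGroup Q] [Module ℂ Q]

/-- The difference of the two sides of `JacobiIdentity`. Unlike the identity itself it can be
transported along homomorphisms of modules. -/
noncomputable def jacobiDefect (YV : V →ₗ[ℂ] VertexOperator ℂ V)
    (YM : V →ₗ[ℂ] VertexOperator ℂ M) (a b : V) (w : M) (l m n : ℤ) : M :=
  (∑ᶠ i : ℕ, ((-1 : ℂ) ^ i * (Ring.choose l i : ℤ)) •
      (YM a).ncoeff (l + m - i) ((YM b).ncoeff (n + i) w))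
    - (∑ᶠ i : ℕ, ((-1 : ℂ) ^ l * (-1 : ℂ) ^ i * (Ring.choose l i : ℤ)) •
      (YM b).ncoeff (l + n - i) ((YM a).ncoeff (m + i) w))
    - ∑ᶠ i : ℕ, ((Ring.choose m i : ℤ) : ℂ) •
      (YM ((YV a).ncoeff (l + i) b)).ncoeff (m + n - i) w

variable {YV : V →ₗ[ℂ] VertexOperator ℂ V} {YM : V →ₗ[ℂ] VertexOperator ℂ M}
  {YQ : V →ₗ[ℂ] VertexOperator ℂ Q}

theorem jacobiIdentity_iff_jacobiDefect_eq_zero :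
    JacobiIdentity YV YM ↔ ∀ a b w l m n, jacobiDefect YV YM a b w l m n = 0 := by
  simp only [JacobiIdentity, jacobiDefect, sub_eq_zero]

theorem map_jacobiDefect {φ : M →ₗ[ℂ] Q}
    (hφ : ∀ a n w, φ ((YM a).ncoeff n w) = (YQ a).ncoeff n (φ w)) (a b : V) (w : M)
    (l m n : ℤ) :
    φ (jacobiDefect YV YM a b w l m n) = jacobiDefect YV YQ a b (φ w) l m n := by
  let evalMode (k : ℤ) : V →ₗ[ℂ] M :=
    LinearMap.applyₗ w ∘ₗ LinearMap.proj k ∘ₗ VertexOperator.ncoeff ∘ₗ YM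
  have hiter : (fun i : ℕ => ((Ring.choose m i : ℤ) : ℂ) •
      (YM ((YV a).ncoeff (l + i) b)).ncoeff (m + n - i) w).HasFiniteSupport :=
    hasFiniteSupport_smul_map_ncoeff (YV a) b l _ fun i => evalMode (m + n - i)
  rw [jacobiDefect, map_sub, map_sub,
    map_finsum φ (hasFiniteSupport_smul_map_ncoeff (YM b) w n _ fun i => (YM a).ncoeff (l + m - i)),
    map_finsum φ (hasFiniteSupport_smul_map_ncoeff (YM a) w m _ fun i => (YM b).ncoeff (l + n - i)),
    map_finsum φ hiter]
  simp only [map_smul, hφ, jacobiDefect]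

theorem JacobiIdentity.of_surjective (h : JacobiIdentity YV YM) {φ : M →ₗ[ℂ] Q}
    (hφ : ∀ a n w, φ ((YM a).ncoeff n w) = (YQ a).ncoeff n (φ w))
    (hsurj : Function.Surjective φ) : JacobiIdentity YV YQ := by
  rw [jacobiIdentity_iff_jacobiDefect_eq_zero] at h ⊢
  refine fun a b x l m n => ?_
  obtain ⟨w, rfl⟩ := hsurj x
  rw [← map_jacobiDefect hφ, h, map_zero]

theorem JacobiIdentity.of_injective (h : JacobiIdentity YV YQ) {φ : M →ₗ[ℂ] Q}
    (hφ : ∀ a n w, φ ((YM a).ncoeff n w) = (YQ a).ncoeff n (φ w))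
    (hinj : Function.Injective φ) : JacobiIdentity YV YM := by
  rw [jacobiIdentity_iff_jacobiDefect_eq_zero] at h ⊢
  refine fun a b w l m n => hinj ?_
  rw [map_jacobiDefect hφ, h, map_zero]

end Jacobi

namespace VertexOperatorAlgebra

namespace WeakModule

variable {V : Type u} [AddCommGroup V] [Module ℂ V] {A : VertexOperatorAlgebra V}
variable {M : Type v} [AddCommGroup M] [Module ℂ M] {W : A.WeakModule M}
variable {M' : Type*} [AddCommGroup M'] [Module ℂ M'] {W' : A.WeakModule M'}

section Hom

variable (W W') in
/-- `φ` is a homomorphism of weak modules: it commutes with all modes. -/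
def IsHom (φ : M →ₗ[ℂ] M') : Prop :=
  ∀ (a : V) (n : ℤ) (w : M), φ (W.mode a n w) = W'.mode a n (φ w)

variable {φ : M →ₗ[ℂ] M'}

theorem IsHom.isSubmodule_map (hφ : IsHom W W' φ) {N : Submodule ℂ M} (hN : W.IsSubmodule N) :
    W'.IsSubmodule (N.map φ) := by
  rintro a n _ ⟨x, hx, rfl⟩
  exact ⟨_, hN a n x hx, hφ a n x⟩

theorem IsHom.isSubmodule_comap (hφ : IsHom W W' φ) {N : Submodule ℂ M'}
    (hN : W'.IsSubmodule N) : W.IsSubmodule (N.comap φ) := fun a n x hx => by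
  rw [Submodule.mem_comap, hφ]
  exact hN a n _ hx

theorem isSubmodule_top : W.IsSubmodule ⊤ := fun _ _ _ _ => Submodule.mem_top

theorem IsHom.isSimpleSubmodule_range (hφ : IsHom W W' φ) (hW : W.IsSimple) (hne : φ ≠ 0) :
    W'.IsSimpleSubmodule (LinearMap.range φ) := by
  refine ⟨LinearMap.range_eq_map φ ▸ hφ.isSubmodule_map isSubmodule_top,
    mt LinearMap.range_eq_bot.1 hne, fun N hle hN => ?_⟩
  have hmap : (N.comap φ).map φ = N := by rw [Submodule.map_comap_eq, inf_eq_right.2 hle]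
  refine (hW.2 _ (hφ.isSubmodule_comap hN)).imp (fun h => ?_) (fun h => ?_)
  · rw [← hmap, h, Submodule.map_bot]
  · rw [← hmap, h, Submodule.map_top]

theorem mem_weightSpace_iff {μ : ℂ} {x : M} :
    x ∈ W.weightSpace μ ↔ W.mode A.ω 1 x = μ • x :=
  Module.End.mem_eigenspace_iff

theorem IsHom.weightSpace_eq_comap (hφ : IsHom W W' φ) (hinj : Function.Injective φ) (μ : ℂ) :
    W.weightSpace μ = (W'.weightSpace μ).comap φ := by
  ext x
  rw [Submodule.mem_comap, mem_weightSpace_iff, mem_weightSpace_iff, ← hφ, ← map_smul,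
    hinj.eq_iff]

theorem IsHom.map_weightSpace_eq (hφ : IsHom W W' φ) (hsurj : Function.Surjective φ)
    (hW : W.IsOrdinary) (μ : ℂ) : (W.weightSpace μ).map φ = W'.weightSpace μ :=
  congrFun (map_eigenspace_eq_of_surjective hsurj (hφ A.ω 1) hW.grading.submodule_iSup_eq_top) μ

theorem Equivalent.weightSpace_eq_bot_iff {M : Type u} [AddCommGroup M] [Module ℂ M]
    {M' : Type v} [AddCommGroup M'] [Module ℂ M'] {W : A.WeakModule M} {W' : A.WeakModule M'}
    (h : W.Equivalent W') (μ : ℂ) : W.weightSpace μ = ⊥ ↔ W'.weightSpace μ = ⊥ := by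
  obtain ⟨e, he⟩ := h
  have he : IsHom W W' (e : M →ₗ[ℂ] M') := he
  rw [he.weightSpace_eq_comap e.injective, Submodule.comap_equiv_eq_map_symm,
    Submodule.map_eq_bot_iff]

theorem isOrdinary_of_iSup_weightSpace_eq_top (htop : ⨆ μ, W.weightSpace μ = ⊤)
    (hfin : ∀ μ, FiniteDimensional ℂ (W.weightSpace μ))
    (hbdd : ∀ μ : ℂ, ∃ k : ℤ, ∀ n : ℤ, n < k → W.weightSpace (μ + n) = ⊥) : W.IsOrdinary :=
  ⟨DirectSum.isInternal_submodule_of_iSupIndep_of_iSup_eq_top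
    (Module.End.eigenspaces_iSupIndep _) htop, hfin, hbdd⟩

theorem IsOrdinary.of_surjective (hW : W.IsOrdinary) (hφ : IsHom W W' φ)
    (hsurj : Function.Surjective φ) : W'.IsOrdinary := by
  have hmap := hφ.map_weightSpace_eq hsurj hW
  refine isOrdinary_of_iSup_weightSpace_eq_top ?_ (fun μ => ?_) (fun μ => ?_)
  · simp only [← hmap, ← Submodule.map_iSup]
    rw [hW.grading.submodule_iSup_eq_top, Submodule.map_top, LinearMap.range_eq_top.2 hsurj]
  · have := hW.finite_dim μ
    rw [← hmap]
    infer_instance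
  · obtain ⟨k, hk⟩ := hW.bounded_below μ
    exact ⟨k, fun n hn => by rw [← hmap, hk n hn, Submodule.map_bot]⟩

end Hom

section Subquotient

theorem eventually_mode_eq_zero (W : A.WeakModule M) (a : V) (x : M) :
    ∀ᶠ n in atTop, W.mode a n x = 0 :=
  eventually_ncoeff_eq_zero (W.Y a) x

theorem mode_vac (W : A.WeakModule M) (n : ℤ) (w : M) :
    W.mode A.vac n w = if n = -1 then w else 0 := by
  rw [mode, W.vacuum]
  split_ifs <;> rfl

variable {N : Submodule ℂ M} (hN : W.IsSubmodule N)

/-- A submodule of a weak module as a weak module. -/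
noncomputable def restrict : A.WeakModule N where
  Y := fieldOfModes
    { toFun := fun a n => (W.mode a n).restrict (hN a n)
      map_add' := fun a b => by ext; simp [mode]
      map_smul' := fun c a => by ext; simp [mode] }
    fun a x => (W.eventually_mode_eq_zero a x).mono fun _ hn => Subtype.ext hn
  vacuum n := by
    ext x
    rw [ncoeff_fieldOfModes]
    refine (W.mode_vac n x).trans ?_
    split_ifs <;> rfl
  jacobi := W.jacobi.of_injective (φ := N.subtype)
    (fun a n w => by rw [ncoeff_fieldOfModes]; rfl) N.subtype_injective

theorem mode_restrict (a : V) (n : ℤ) :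
    (restrict hN).mode a n = (W.mode a n).restrict (hN a n) := by
  rw [restrict, mode, ncoeff_fieldOfModes]
  rfl

theorem isHom_subtype : IsHom (restrict hN) W N.subtype := fun a n x => by
  rw [mode_restrict]
  rfl

/-- The quotient of a weak module by a submodule. -/
noncomputable def quotient : A.WeakModule (M ⧸ N) where
  Y := fieldOfModes
    { toFun := fun a n => N.mapQ N (W.mode a n) (hN a n)
      map_add' := fun a b => by ext; simp [mode]
      map_smul' := fun c a => by ext; simp [mode] }
    fun a x => by
      obtain ⟨x, rfl⟩ := N.mkQ_surjective x
      filter_upwards [W.eventually_mode_eq_zero a x] with n hn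
      simp [hn]
  vacuum n := by
    ext x
    rw [ncoeff_fieldOfModes]
    refine (congrArg N.mkQ (W.mode_vac n x)).trans ?_
    split_ifs <;> simp
  jacobi := W.jacobi.of_surjective (φ := N.mkQ)
    (fun a n w => by rw [ncoeff_fieldOfModes]; rfl) N.mkQ_surjective

theorem mode_quotient (a : V) (n : ℤ) :
    (quotient hN).mode a n = N.mapQ N (W.mode a n) (hN a n) := by
  rw [quotient, mode, ncoeff_fieldOfModes]
  rfl

theorem isHom_mkQ : IsHom W (quotient hN) N.mkQ := fun a n x => by
  rw [mode_quotient]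
  rfl

theorem IsOrdinary.quotient (hW : W.IsOrdinary) : (quotient hN).IsOrdinary :=
  hW.of_surjective (isHom_mkQ hN) N.mkQ_surjective

theorem IsOrdinary.restrict (hW : W.IsOrdinary) : (restrict hN).IsOrdinary := by
  have hcomap := (isHom_subtype hN).weightSpace_eq_comap N.subtype_injective
  refine isOrdinary_of_iSup_weightSpace_eq_top ?_ (fun μ => ?_) (fun μ => ?_)
  · simp only [hcomap]
    exact iSup_comap_subtype_eigenspace_eq_top (hN A.ω 1) hW.grading.submodule_iSup_eq_top
  · have := hW.finite_dim μ
    have hmaps : ∀ x ∈ (WeakModule.restrict hN).weightSpace μ, N.subtype x ∈ W.weightSpace μ :=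
      fun x hx => by rwa [hcomap] at hx
    exact Module.Finite.of_injective (N.subtype.restrict hmaps)
      fun x y h => Subtype.ext <| N.subtype_injective <|
        congrArg (Subtype.val : W.weightSpace μ → M) h
  · obtain ⟨k, hk⟩ := hW.bounded_below μ
    refine ⟨k, fun n hn => ?_⟩
    rw [hcomap, hk n hn, Submodule.comap_bot, Submodule.ker_subtype]

end Subquotient

section ModeAlgebra

variable (W) in
/-- The associative algebra of operators on `M` generated by the modes. Its submodules are those of
the weak module, which makes the theory of semisimple modules over a ring available. -/
noncomputable abbrev modeAlgebra : Subalgebra ℂ (Module.End ℂ M) :=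
  Algebra.adjoin ℂ {f | ∃ a n, f = W.mode a n}

theorem IsSubmodule.apply_mem {N : Submodule ℂ M} (hN : W.IsSubmodule N) {f : Module.End ℂ M}
    (hf : f ∈ W.modeAlgebra) : ∀ x ∈ N, f x ∈ N := by
  induction hf using Algebra.adjoin_induction with
  | mem _ hf =>
    obtain ⟨a, n, rfl⟩ := hf
    exact hN a n
  | algebraMap c => exact fun x hx => N.smul_mem c hx
  | add _ _ _ _ hf hg => exact fun x hx => N.add_mem (hf x hx) (hg x hx)
  | mul _ _ _ _ hf hg => exact fun x hx => hf _ (hg x hx)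

theorem isSubmodule_restrictScalars (N : Submodule W.modeAlgebra M) :
    W.IsSubmodule (N.restrictScalars ℂ) := fun a n _ hx =>
  N.smul_mem ⟨W.mode a n, Algebra.subset_adjoin ⟨a, n, rfl⟩⟩ hx

theorem IsSubmodule.exists_restrictScalars_eq {N : Submodule ℂ M} (hN : W.IsSubmodule N) :
    ∃ N' : Submodule W.modeAlgebra M, N'.restrictScalars ℂ = N :=
  ⟨{ __ := N, smul_mem' := fun f _ hx => hN.apply_mem f.2 _ hx }, rfl⟩

theorem isSimpleSubmodule_restrictScalars_iff {N : Submodule W.modeAlgebra M} :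
    W.IsSimpleSubmodule (N.restrictScalars ℂ) ↔ IsSimpleModule W.modeAlgebra N := by
  rw [isSimpleModule_iff_isAtom]
  constructor
  · rintro ⟨-, hne, hmin⟩
    refine ⟨fun h => hne ((Submodule.restrictScalars_eq_bot_iff ℂ _ _).2 h),
      fun K hK => ?_⟩
    refine (hmin _ hK.le (isSubmodule_restrictScalars K)).elim
      (Submodule.restrictScalars_eq_bot_iff ℂ _ _).1 fun h => ?_
    exact absurd (Submodule.restrictScalars_injective ℂ _ _ h) hK.ne
  · intro hN
    refine ⟨isSubmodule_restrictScalars N, mt (Submodule.restrictScalars_eq_bot_iff ℂ _ _).1 hN.1,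
      fun K hle hK => ?_⟩
    obtain ⟨K, rfl⟩ := hK.exists_restrictScalars_eq
    exact (hN.le_iff.1 hle).imp (Submodule.restrictScalars_eq_bot_iff ℂ _ _).2
      (congrArg (Submodule.restrictScalars ℂ))

theorem isSimple_quotient_of_isCoatom {P : Submodule W.modeAlgebra M} (hP : IsCoatom P) :
    (quotient (isSubmodule_restrictScalars P)).IsSimple := by
  refine ⟨Submodule.Quotient.nontrivial_iff.2 <|
    mt (Submodule.restrictScalars_eq_top_iff ℂ _ _).1 hP.1, fun K hK => ?_⟩
  have hcomap := (isHom_mkQ (isSubmodule_restrictScalars P)).isSubmodule_comap hK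
  obtain ⟨L, hL⟩ := hcomap.exists_restrictScalars_eq
  have hPL : P ≤ L := (Submodule.le_comap_mkQ _ K).trans hL.ge
  have hK : (L.restrictScalars ℂ).map (P.restrictScalars ℂ).mkQ = K := by
    rw [hL, Submodule.map_comap_eq_of_surjective (Submodule.mkQ_surjective _)]
  rcases hP.le_iff.1 hPL with rfl | rfl
  · right
    rw [← hK, Submodule.restrictScalars_top, Submodule.map_top, Submodule.range_mkQ]
  · left
    rw [← hK, Submodule.mkQ_map_self]

theorem exists_simple_quotient_of_generator {w : M} (hw : w ≠ 0)
    (hgen : ∀ K, W.IsSubmodule K → w ∈ K → K = ⊤) :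
    ∃ (P : Submodule ℂ M) (hP : W.IsSubmodule P), (quotient hP).IsSimple ∧ w ∉ P := by
  have hspan : Submodule.span W.modeAlgebra {w} = ⊤ :=
    (Submodule.restrictScalars_eq_top_iff ℂ _ _).1 <|
      hgen _ (isSubmodule_restrictScalars _) (Submodule.mem_span_singleton_self w)
  have : Module.Finite W.modeAlgebra M := ⟨⟨{w}, by rwa [Finset.coe_singleton]⟩⟩
  have : Nontrivial M := ⟨w, 0, hw⟩
  obtain ⟨P, hP⟩ := IsCoatomic.exists_coatom (Submodule W.modeAlgebra M)
  refine ⟨_, isSubmodule_restrictScalars P, isSimple_quotient_of_isCoatom hP, fun hwP => hP.1 ?_⟩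
  exact (Submodule.restrictScalars_eq_top_iff ℂ _ _).1 (hgen _ (isSubmodule_restrictScalars P) hwP)

variable (W) in
theorem exists_simple_subquotient {w : M} (hw : w ≠ 0) :
    ∃ (N : Submodule ℂ M) (hN : W.IsSubmodule N) (P : Submodule ℂ N)
      (hP : (restrict hN).IsSubmodule P) (hwN : w ∈ N),
      (quotient hP).IsSimple ∧ (⟨w, hwN⟩ : N) ∉ P := by
  let N := (Submodule.span W.modeAlgebra {w}).restrictScalars ℂ
  have hN : W.IsSubmodule N := isSubmodule_restrictScalars _
  have hwN : w ∈ N := Submodule.mem_span_singleton_self w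
  obtain ⟨P, hP, hsimple, hwP⟩ := exists_simple_quotient_of_generator (W := restrict hN)
    (w := ⟨w, hwN⟩) (fun h => hw (congrArg Subtype.val h)) fun K hK hwK => by
      obtain ⟨L, hL⟩ := ((isHom_subtype hN).isSubmodule_map hK).exists_restrictScalars_eq
      have hwL : w ∈ L.restrictScalars ℂ := hL ▸ ⟨_, hwK, rfl⟩
      have hNL : N ≤ K.map N.subtype := hL ▸ Submodule.span_le.2 (Set.singleton_subset_iff.2 hwL)
      rw [eq_top_iff, ← Submodule.map_le_map_iff_of_injective N.subtype_injective]
      exact (Submodule.map_subtype_top N).trans_le hNL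
  exact ⟨N, hN, P, hP, hwN, hsimple, hwP⟩

end ModeAlgebra

section Socle

variable (W) in
/-- The socle of a weak module: the sum of its simple submodules. -/
def socle : Submodule ℂ M :=
  sSup {S | W.IsSimpleSubmodule S}

variable (W) in
theorem restrictScalars_sSup_isSimpleModule :
    (sSup {S : Submodule W.modeAlgebra M | IsSimpleModule W.modeAlgebra S}).restrictScalars ℂ
      = W.socle := by
  rw [Submodule.restrictScalars_sSup, socle]
  congr 1
  ext S
  constructor
  · rintro ⟨S, hS, rfl⟩
    exact isSimpleSubmodule_restrictScalars_iff.2 hS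
  · intro hS
    obtain ⟨S, rfl⟩ := hS.1.exists_restrictScalars_eq
    exact ⟨S, isSimpleSubmodule_restrictScalars_iff.1 hS, rfl⟩

variable (W) in
theorem isSubmodule_socle : W.IsSubmodule W.socle :=
  restrictScalars_sSup_isSimpleModule W ▸ isSubmodule_restrictScalars _

theorem isCompletelyReducible_of_isSemisimpleModule [IsSemisimpleModule W.modeAlgebra M] :
    W.IsCompletelyReducible := by
  obtain ⟨s, hind, htop, hs⟩ :=
    IsSemisimpleModule.exists_sSupIndep_sSup_simples_eq_top W.modeAlgebra M
  have hind' : iSupIndep fun N : s => N.1.restrictScalars ℂ := fun N => by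
    have hdisj := (sSupIndep_iff s).1 hind N
    simp_rw [← Submodule.restrictScalars_iSup]
    rw [Submodule.disjoint_def] at hdisj ⊢
    exact hdisj
  have htop' : ⨆ N : s, N.1.restrictScalars ℂ = ⊤ := by
    rw [← Submodule.restrictScalars_iSup, ← sSup_eq_iSup', htop, Submodule.restrictScalars_top]
  refine ⟨s, fun N => N.1.restrictScalars ℂ,
    fun N => isSimpleSubmodule_restrictScalars_iff.2 (hs N.1 N.2), ?_⟩
  convert DirectSum.isInternal_submodule_of_iSupIndep_of_iSup_eq_top hind' htop'

theorem isCompletelyReducible_of_socle_eq_top (h : W.socle = ⊤) : W.IsCompletelyReducible := by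
  have : IsSemisimpleModule W.modeAlgebra M := .of_sSup_simples_eq_top <|
    (Submodule.restrictScalars_eq_top_iff ℂ _ _).1 (W.restrictScalars_sSup_isSimpleModule.trans h)
  exact isCompletelyReducible_of_isSemisimpleModule

end Socle

section VacuumLike

variable (W) in
theorem jacobi_mode (a b : V) (w : M) (l m n : ℤ) :
    (∑ᶠ i : ℕ, ((-1 : ℂ) ^ i * (Ring.choose l i : ℤ)) •
        W.mode a (l + m - i) (W.mode b (n + i) w))
      - (∑ᶠ i : ℕ, ((-1 : ℂ) ^ l * (-1 : ℂ) ^ i * (Ring.choose l i : ℤ)) •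
        W.mode b (l + n - i) (W.mode a (m + i) w))
      = ∑ᶠ i : ℕ, ((Ring.choose m i : ℤ) : ℂ) •
        W.mode (A.adjoint.mode a (l + i) b) (m + n - i) w :=
  W.jacobi a b w l m n

variable (W) in
theorem mode_zero_commutator (a b : V) (n : ℤ) (w : M) :
    W.mode a 0 (W.mode b n w) - W.mode b n (W.mode a 0 w)
      = W.mode (A.adjoint.mode a 0 b) n w := by
  have hchoose (i : ℕ) (hi : i ≠ 0) : Ring.choose (0 : ℤ) i = 0 :=
    Ring.choose_zero_pos ℤ (Nat.pos_of_ne_zero hi)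
  have h := W.jacobi_mode a b w 0 0 n
  rw [finsum_eq_single _ 0 fun i hi => by simp [hchoose i hi],
    finsum_eq_single _ 0 fun i hi => by simp [hchoose i hi],
    finsum_eq_single _ 0 fun i hi => by simp [hchoose i hi]] at h
  simpa using h

variable (W) in
theorem mode_mode_neg_two_vac (a : V) (n : ℤ) (w : M) :
    W.mode (A.adjoint.mode a (-2) A.vac) n w = (-(n : ℂ)) • W.mode a (n - 1) w := by
  -- With these indices only one mode of the vacuum survives on the left of the Jacobi identity.
  have h := W.jacobi_mode a A.vac w (-2) (n + 1) (-1)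
  have hleft : ∑ᶠ i : ℕ, ((-1 : ℂ) ^ i * (Ring.choose (-2 : ℤ) i : ℤ)) •
      W.mode a (-2 + (n + 1) - i) (W.mode A.vac (-1 + i) w) = W.mode a (n - 1) w := by
    rw [finsum_eq_single _ 0 fun i hi => by
      rw [mode_vac, if_neg (by lia), map_zero, smul_zero]]
    simp [mode_vac, show -2 + (n + 1) = n - 1 by ring]
  have hright : ∑ᶠ i : ℕ, ((-1 : ℂ) ^ (-2 : ℤ) * (-1 : ℂ) ^ i * (Ring.choose (-2 : ℤ) i : ℤ)) •
      W.mode A.vac (-2 + -1 - i) (W.mode a (n + 1 + i) w) = 0 :=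
    finsum_eq_zero_of_forall_eq_zero fun i => by rw [mode_vac, if_neg (by lia), smul_zero]
  have hiter : ∑ᶠ i : ℕ, ((Ring.choose (n + 1) i : ℤ) : ℂ) •
        W.mode (A.adjoint.mode a (-2 + i) A.vac) (n + 1 + -1 - i) w
      = W.mode (A.adjoint.mode a (-2) A.vac) n w + ((n : ℂ) + 1) • W.mode a (n - 1) w := by
    have hcreation (i : ℕ) (hi : i ∉ Finset.range 2) : A.adjoint.mode a (-2 + i) A.vac = 0 :=
      A.creation a _ (by rw [Finset.mem_range] at hi; lia)
    have hsupp (i : ℕ) (hi : i ∉ Finset.range 2) : ((Ring.choose (n + 1) i : ℤ) : ℂ) •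
        W.mode (A.adjoint.mode a (-2 + i) A.vac) (n + 1 + -1 - i) w = 0 := by
      rw [hcreation i hi]
      simp [mode]
    rw [finsum_eq_sum_of_support_subset (s := Finset.range 2) _ fun i hi =>
      by_contra fun hlt => hi (hsupp i hlt)]
    have hneg : A.adjoint.mode a (-1) A.vac = a := A.creation_neg_one a
    simp [Finset.sum_range_succ, hneg]
  rw [hleft, hright, hiter, sub_zero] at h
  rw [← sub_eq_iff_eq_add.2 h]
  module

theorem adjoint_mode_omega_zero (a : V) :
    A.adjoint.mode A.ω 0 a = A.adjoint.mode a (-2) A.vac := by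
  have h := LinearMap.congr_fun (A.derivative a (-1)) A.vac
  rw [A.creation_neg_one] at h
  simpa [mode, adjoint] using h

variable (W) in
theorem mode_omega_zero_commutator (a : V) (n : ℤ) (w : M) :
    W.mode A.ω 0 (W.mode a n w) - W.mode a n (W.mode A.ω 0 w)
      = (-(n : ℂ)) • W.mode a (n - 1) w := by
  rw [mode_zero_commutator, adjoint_mode_omega_zero, mode_mode_neg_two_vac]

theorem mode_omega_zero_mem_weightSpace {μ : ℂ} {w : M} (hw : w ∈ W.weightSpace μ) :
    W.mode A.ω 0 w ∈ W.weightSpace (μ + 1) := by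
  rw [mem_weightSpace_iff] at hw ⊢
  have h := W.mode_omega_zero_commutator A.ω 1 w
  rw [hw, map_smul, sub_self, Int.cast_one] at h
  rw [← sub_sub_self (μ • W.mode A.ω 0 w) (W.mode A.ω 1 (W.mode A.ω 0 w)), h]
  module

variable (W) in
/-- Vacuum-like vectors: those annihilated, like the vacuum, by all modes `aₙ` with `n ≥ 0`. -/
def IsVacuumLike (w : M) : Prop :=
  ∀ (a : V) (n : ℤ), 0 ≤ n → W.mode a n w = 0

theorem isVacuumLike_of_mode_omega_zero_eq_zero {w : M} (hw : W.mode A.ω 0 w = 0) :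
    W.IsVacuumLike w := by
  intro a
  -- `[L(-1), aₙ₊₁] = -(n + 1) aₙ` carries the vanishing down from large `n`.
  have hstep (n : ℤ) (hn : 0 ≤ n) (h : W.mode a (n + 1) w = 0) : W.mode a n w = 0 := by
    have hcomm := W.mode_omega_zero_commutator a (n + 1) w
    rw [h, hw, map_zero, map_zero, sub_zero, add_sub_cancel_right] at hcomm
    refine (smul_eq_zero.1 hcomm.symm).resolve_left (neg_ne_zero.2 ?_)
    exact_mod_cast (by lia : n + 1 ≠ 0)
  obtain ⟨N, hN⟩ := eventually_atTop.1 (W.eventually_mode_eq_zero a w)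
  intro n hn
  rcases le_total N n with h | h
  · exact hN n h
  · induction n, h using Int.leInductionDown with
    | base => exact hN N le_rfl
    | pred k _ ih => exact hstep (k - 1) hn (by rw [sub_add_cancel]; exact ih (by lia))

variable (W) in
/-- The linear map $a \mapsto a_{-1} w$ from `V` to a weak module. For vacuum-like `w` it is the
homomorphism of modules that takes the vacuum to `w`. -/
noncomputable def creationMap (w : M) : V →ₗ[ℂ] M where
  toFun a := W.mode a (-1) w
  map_add' a b := by simp [mode]
  map_smul' c a := by simp [mode]

variable (W) in
theorem creationMap_vac (w : M) : W.creationMap w A.vac = w :=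
  (W.mode_vac (-1) w).trans (if_pos rfl)

theorem IsVacuumLike.isHom_creationMap {w : M} (hw : W.IsVacuumLike w) :
    IsHom A.adjoint W (W.creationMap w) := by
  intro a n b
  have h := W.jacobi_mode a b w n 0 (-1)
  rw [finsum_eq_single _ 0 fun i hi => by rw [hw b _ (by lia), map_zero, smul_zero],
    finsum_eq_zero_of_forall_eq_zero fun i => by rw [hw a _ (by lia), map_zero, smul_zero],
    finsum_eq_single _ 0 fun i hi => by
      simp [Ring.choose_zero_pos ℤ (Nat.pos_of_ne_zero hi)]] at h
  change W.mode _ (-1) w = W.mode a n (W.mode b (-1) w)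
  simpa using h.symm

theorem IsVacuumLike.mem_socle {w : M} (hw : W.IsVacuumLike w) (hA : A.adjoint.IsSimple) :
    w ∈ W.socle := by
  rcases eq_or_ne w 0 with rfl | hw0
  · exact zero_mem _
  have hne : W.creationMap w ≠ 0 := fun h => hw0 (by rw [← W.creationMap_vac w, h]; rfl)
  have hle : LinearMap.range (W.creationMap w) ≤ W.socle :=
    le_sSup (hw.isHom_creationMap.isSimpleSubmodule_range hA hne)
  exact hle ⟨A.vac, W.creationMap_vac w⟩

theorem weightSpace_zero_le_socle (hA : A.adjoint.IsSimple) (h1 : W.weightSpace 1 = ⊥) :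
    W.weightSpace 0 ≤ W.socle := fun w hw => by
  have hL := mode_omega_zero_mem_weightSpace hw
  rw [zero_add, h1, Submodule.mem_bot] at hL
  exact (isVacuumLike_of_mode_omega_zero_eq_zero hL).mem_socle hA

end VacuumLike

end WeakModule

section Holomorphic

open WeakModule

variable {V : Type u} [AddCommGroup V] [Module ℂ V] {A : VertexOperatorAlgebra V}
variable {M : Type v} [AddCommGroup M] [Module ℂ M] {W : A.WeakModule M}

theorem weightSpace_adjoint_zero_ne_bot [Nontrivial V] : A.adjoint.weightSpace 0 ≠ ⊥ := by
  obtain ⟨a, ha⟩ := exists_ne (0 : V)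
  refine (Submodule.ne_bot_iff _).2 ⟨A.vac, mem_weightSpace_iff.2 ?_, fun h => ha ?_⟩
  · rw [zero_smul]
    exact A.creation A.ω 1 zero_le_one
  · rw [← A.creation_neg_one a, h, map_zero]

theorem IsHolomorphic.exists_equivalent_subquotient (hol : IsHolomorphic.{u, v} A)
    (hW : W.IsOrdinary) {w : M} (hw : w ≠ 0) :
    ∃ (N : Submodule ℂ M) (hN : W.IsSubmodule N) (P : Submodule ℂ N)
      (hP : (restrict hN).IsSubmodule P) (hwN : w ∈ N),
      A.adjoint.Equivalent (quotient hP) ∧ (⟨w, hwN⟩ : N) ∉ P := by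
  obtain ⟨N, hN, P, hP, hwN, hsimple, hwP⟩ := W.exists_simple_subquotient hw
  exact ⟨N, hN, P, hP, hwN, hol.2 _ _ ((hW.restrict hN).quotient hP) hsimple, hwP⟩

theorem IsHolomorphic.weightSpace_eq_bot_of_adjoint (hol : IsHolomorphic.{u, v} A)
    (hW : W.IsOrdinary) {μ : ℂ} (hμ : A.adjoint.weightSpace μ = ⊥) : W.weightSpace μ = ⊥ := by
  refine (Submodule.eq_bot_iff _).2 fun w hwμ => by_contra fun hw => ?_
  obtain ⟨N, hN, P, hP, hwN, hequiv, hwP⟩ := hol.exists_equivalent_subquotient hW hw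
  have hwN' : (⟨w, hwN⟩ : N) ∈ (restrict hN).weightSpace μ := by
    rwa [(isHom_subtype hN).weightSpace_eq_comap N.subtype_injective]
  have hwQ := Submodule.mem_map_of_mem (f := P.mkQ) hwN'
  rw [(isHom_mkQ hP).map_weightSpace_eq P.mkQ_surjective (hW.restrict hN),
    (hequiv.weightSpace_eq_bot_iff μ).1 hμ, Submodule.mem_bot] at hwQ
  exact hwP ((Submodule.Quotient.mk_eq_zero P).1 hwQ)

theorem IsHolomorphic.weightSpace_zero_ne_bot [Nontrivial M] (hol : IsHolomorphic.{u, v} A)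
    (hW : W.IsOrdinary) : W.weightSpace 0 ≠ ⊥ := by
  intro h0
  have := hol.1.1
  obtain ⟨w, hw⟩ := exists_ne (0 : M)
  obtain ⟨N, hN, P, hP, -, hequiv, -⟩ := hol.exists_equivalent_subquotient hW hw
  refine weightSpace_adjoint_zero_ne_bot ((hequiv.weightSpace_eq_bot_iff 0).2 ?_)
  rw [← (isHom_mkQ hP).map_weightSpace_eq P.mkQ_surjective (hW.restrict hN),
    (isHom_subtype hN).weightSpace_eq_comap N.subtype_injective, h0, Submodule.comap_bot,
    Submodule.ker_subtype, Submodule.map_bot]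

theorem IsHolomorphic.eq_top_of_weightSpace_zero_le (hol : IsHolomorphic.{u, v} A)
    (hW : W.IsOrdinary) {N : Submodule ℂ M} (hN : W.IsSubmodule N) (hle : W.weightSpace 0 ≤ N) :
    N = ⊤ := by
  by_contra hne
  have : Nontrivial (M ⧸ N) := Submodule.Quotient.nontrivial_iff.2 hne
  refine hol.weightSpace_zero_ne_bot (hW.quotient hN) ?_
  rwa [← (isHom_mkQ hN).map_weightSpace_eq N.mkQ_surjective hW, ← LinearMap.le_ker_iff_map,
    Submodule.ker_mkQ]

end Holomorphic

end VertexOperatorAlgebra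

theorem proposition9 {V : Type u} [AddCommGroup V] [Module ℂ V]
    (A : VertexOperatorAlgebra V)
    (hol : VertexOperatorAlgebra.IsHolomorphic.{u, v} A)
    (hV1 : A.weightSpace 1 = ⊥)
    {M : Type v} [AddCommGroup M] [Module ℂ M]
    (W : A.WeakModule M) (hW : W.IsOrdinary) :
    W.IsCompletelyReducible := by
  have hadj : A.adjoint.weightSpace 1 = ⊥ := by
    rwa [VertexOperatorAlgebra.weightSpace, Int.cast_one] at hV1
  have hM1 : W.weightSpace 1 = ⊥ := hol.weightSpace_eq_bot_of_adjoint hW hadj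
  have hM0 : W.weightSpace 0 ≤ W.socle :=
    VertexOperatorAlgebra.WeakModule.weightSpace_zero_le_socle hol.1 hM1
  exact VertexOperatorAlgebra.WeakModule.isCompletelyReducible_of_socle_eq_top
    (hol.eq_top_of_weightSpace_zero_le hW W.isSubmodule_socle hM0)
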